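/- Let $f$ be an $\mathbb{R}^n$-valued function on $\mathbb{R}^m$ that is differentiable in a neighbourhood of a point $x\in\mathbb{R}^m$, and assume $x\neq 0$, $f(x)\neq 0$ and $Df(x)\neq 0$. Let $\|\cdot\|$ be the Euclidean norm, let $\log$ be the logarithm to base $2$, put $k=\min\{m,n\}$, and for $\delta>0$ let $$P(x,\delta)=\{x'\in\mathbb{R}^m:\ \|x'-x\|\le\delta\|x\|\},\qquad q_\delta(x')=\frac{\|f(x')-f(x)\|}{\delta\,\|f(x)\|}.$$ Write $\mathbb{E}_{x'\sim P(x,\delta)}$ for the expectation when $x'$ is uniformly distributed in $P(x,\delta)$, and define $$\mathrm{WNC}(x)=\lim_{\delta\to0^+}\ \sup_{x'\in P(x,\delta)}q_\delta(x'),\qquad \mathrm{SNC}(x)=\lim_{\delta\to0^+}\ \mathbb{E}_{x'\sim P(x,\delta)}\,q_\delta(x'),$$ $$\mathrm{SNLP}(x)=\lim_{\delta\to0^+}\ \mathbb{E}_{x'\sim P(x,\delta)}\,\log q_\delta(x'),$$ where $\mathrm{SNLP}(x)$ is said to exist if $\log q_\delta$ has a finite expectation for all small $\delta>0$ (in particular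 $q_\delta\ne0$ almost everywhere on $P(x,\delta)$) and these expectations have a finite limit. Then the limits $\mathrm{WNC}(x)>0$ and $\mathrm{SNC}(x)$ exist (the suprema and expectations being finite for all small $\delta>0$), and $$\frac{1}{e\sqrt m}\ \le\ \frac{\mathrm{SNC}(x)}{\mathrm{WNC}(x)}\ \le\ \sqrt{\frac{k}{m+2}}.$$ Moreover, whenever $\mathrm{SNLP}(x)$ exists, $$\mathrm{SNLP}(x)-\log\mathrm{WNC}(x)\ \le\ \frac{\log k-\log(m+2)}{2}.$$ If in addition $f$ is strictly differentiable at $x$ (for instance, if $f$ is continuously differentiable near $x$), then $\mathrm{SNLP}(x)$ exists and $$-\frac{\log m}{2}-\log e\ \le\ \mathrm{SNLP}(x)-\log\mathrm{WNC}(x)\ \le\ \frac{\log k-\log(m+2)}{2}.$$ -/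

import Mathlib

open MeasureTheory Filter Topology

noncomputable section

/-- The set of admissible perturbed inputs `{x' : ‖x' - x‖ ≤ δ ‖x‖}`. -/
def perturbationSet {m : ℕ} (x : EuclideanSpace ℝ (Fin m)) (δ : ℝ) :
    Set (EuclideanSpace ℝ (Fin m)) :=
  {x' | ‖x' - x‖ ≤ δ * ‖x‖}

/-- The relative error of the output divided by `δ`: `‖f x' - f x‖ / (δ ‖f x‖)`. -/
def errorQuotient {m n : ℕ} (f : EuclideanSpace ℝ (Fin m) → EuclideanSpace ℝ (Fin n))
    (x : EuclideanSpace ℝ (Fin m)) (δ : ℝ) (x' : EuclideanSpace ℝ (Fin m)) : ℝ :=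
  ‖f x' - f x‖ / (δ * ‖f x‖)

/-- `W` is the worst-case norm-wise condition number of `f` at `x`: for all small `δ > 0` the
error quotient has a finite supremum on the perturbation set, and these suprema tend to `W`. -/
def IsWNC {m n : ℕ} (f : EuclideanSpace ℝ (Fin m) → EuclideanSpace ℝ (Fin n))
    (x : EuclideanSpace ℝ (Fin m)) (W : ℝ) : Prop :=
  (∀ᶠ δ in 𝓝[>] (0 : ℝ), BddAbove (errorQuotient f x δ '' perturbationSet x δ)) ∧
    Tendsto (fun δ : ℝ => sSup (errorQuotient f x δ '' perturbationSet x δ)) (𝓝[>] 0) (𝓝 W)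

/-- `S` is the stochastic norm-wise condition number of `f` at `x`: for all small `δ > 0` the
error quotient has a finite expectation with respect to the uniform distribution on the
perturbation set, and these expectations tend to `S`. -/
def IsSNC {m n : ℕ} (f : EuclideanSpace ℝ (Fin m) → EuclideanSpace ℝ (Fin n))
    (x : EuclideanSpace ℝ (Fin m)) (S : ℝ) : Prop :=
  (∀ᶠ δ in 𝓝[>] (0 : ℝ), IntegrableOn (errorQuotient f x δ) (perturbationSet x δ) volume) ∧
    Tendsto (fun δ : ℝ => ⨍ x' in perturbationSet x δ, errorQuotient f x δ x' ∂volume)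
      (𝓝[>] 0) (𝓝 S)

/-- `L` is the stochastic norm-wise loss of precision of `f` at `x`: for all small `δ > 0` the
base-2 logarithm of the error quotient has a finite expectation with respect to the uniform
distribution on the perturbation set, and these expectations tend to `L`. Since `log 0 = -∞`,
finiteness includes that the error quotient vanishes only on a null set. -/
def IsSNLP {m n : ℕ} (f : EuclideanSpace ℝ (Fin m) → EuclideanSpace ℝ (Fin n))
    (x : EuclideanSpace ℝ (Fin m)) (L : ℝ) : Prop :=
  (∀ᶠ δ in 𝓝[>] (0 : ℝ),
    (∀ᵐ x' ∂(volume.restrict (perturbationSet x δ)), errorQuotient f x δ x' ≠ 0) ∧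
      IntegrableOn (fun x' => Real.logb 2 (errorQuotient f x δ x'))
        (perturbationSet x δ) volume) ∧
    Tendsto
      (fun δ : ℝ => ⨍ x' in perturbationSet x δ, Real.logb 2 (errorQuotient f x δ x') ∂volume)
      (𝓝[>] 0) (𝓝 L)

end

/-! Put `A = Df(x)` and `c = ‖x‖ / ‖f x‖`. Substituting `x' = x + δ‖x‖u` turns the error quotient
into a function of `u` in the unit ball that converges uniformly to `c‖A u‖`
(`eventually_abs_errorQuotient_sub_le`). Hence WNC is `W = c‖A‖` and SNC is the mean of `c‖A u‖`.

The upper bound is Cauchy–Schwarz together with `E‖A u‖² ≤ ‖A‖² k/(m+2)`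
(`integral_norm_map_sq_le`). Jensen's inequality, applied to the quotients before the limit, carries
it over to the loss of precision.

For the lower bound, a top singular pair gives `‖A u‖ ≥ ‖A‖ |⟪v, u⟫|`. The slab `|⟪v, u⟫| ≤ t` has
chords of length at most `2t` along `v`, so by Fubini and a comparison of ball volumes its
probability is at most `√m t` (`cond_closedBall_abs_le`). The resulting exponential tail gives `E
log(c‖A u‖) ≥ log W - (log m)/2 - 1`, and Jensen turns this into the bound on SNC.

Existence of SNLP needs more than uniform convergence, because `log` is unbounded near `0`. Strict
differentiability makes the component of `f` along `w` grow along `v` at a rate bounded below, so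
the slab argument gives a tail estimate uniform in `δ` (`eventually_errorQuotient_growth`), and the
means converge by truncation (`tendsto_integral_of_tail`). -/

/-! ### Ball volumes and the slab estimate. -/

theorem Real.Gamma_add_half_le {s : ℝ} (hs : 0 < s) :
    Real.Gamma (s + 1 / 2) ≤ √s * Real.Gamma s := by
  -- Log-convexity of `Γ` at the midpoint of `s` and `s + 1`.
  have h := Real.Gamma_mul_add_mul_le_rpow_Gamma_mul_rpow_Gamma hs (by linarith : 0 < s + 1)
    (by norm_num : (0 : ℝ) < 1 / 2) (by norm_num : (0 : ℝ) < 1 / 2) (by norm_num)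
  have hG := Real.Gamma_pos_of_pos hs
  rw [show 1 / 2 * s + 1 / 2 * (s + 1) = s + 1 / 2 by ring, Real.Gamma_add_one hs.ne',
    ← Real.sqrt_eq_rpow, ← Real.sqrt_eq_rpow, Real.sqrt_mul hs.le] at h
  calc _ ≤ _ := h
    _ = √s * (√(Real.Gamma s) * √(Real.Gamma s)) := by ring
    _ = _ := by rw [Real.mul_self_sqrt hG.le]

/-- Consecutive volumes of Euclidean unit balls: `2 ω_d ≤ √(d + 1) ω_{d+1}`. -/
theorem two_mul_volume_closedBall_le (d : ℕ) :
    2 * volume (Metric.closedBall (0 : EuclideanSpace ℝ (Fin d)) 1) ≤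
      ENNReal.ofReal √((d + 1 : ℕ) : ℝ) *
        volume (Metric.closedBall (0 : EuclideanSpace ℝ (Fin (d + 1))) 1) := by
  have h2 : (2 : ENNReal) = ENNReal.ofReal 2 := by simp
  rcases Nat.eq_zero_or_pos d with rfl | hd
  -- The general volume formula needs a nonempty index type; for `d = 0` the inequality is the
  -- equality `2 = 2`.
  · have h0 : volume (Metric.closedBall (0 : EuclideanSpace ℝ (Fin 0)) 1) = 1 := by
      have : Metric.closedBall (0 : EuclideanSpace ℝ (Fin 0)) 1 =
          WithLp.ofLp ⁻¹' (Set.univ : Set (Fin 0 → ℝ)) := by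
        ext y
        simp [Subsingleton.elim y 0]
      rw [this, (PiLp.volume_preserving_ofLp (Fin 0)).measure_preimage
        MeasurableSet.univ.nullMeasurableSet, volume_pi, Measure.pi_univ]
      simp
    have hG : Real.Gamma (1 / 2 + 1) = 1 / 2 * √Real.pi := by
      rw [Real.Gamma_add_one (by norm_num), Real.Gamma_one_half_eq]
    have hpi : 0 < √Real.pi := Real.sqrt_pos.2 Real.pi_pos
    have h1 : √Real.pi / (1 / 2 * √Real.pi) = 2 := by field_simp
    rw [h0, EuclideanSpace.volume_closedBall]
    simp only [ENNReal.ofReal_one, one_mul, Fintype.card_fin, zero_add, Nat.cast_one,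
      pow_one, Real.sqrt_one, mul_one]
    rw [hG, h1, h2]
  · have : Nonempty (Fin d) := ⟨⟨0, hd⟩⟩
    rw [EuclideanSpace.volume_closedBall, EuclideanSpace.volume_closedBall]
    simp only [ENNReal.ofReal_one, one_pow, one_mul, Fintype.card_fin]
    rw [h2, ← ENNReal.ofReal_mul (by norm_num), ← ENNReal.ofReal_mul (Real.sqrt_nonneg _)]
    apply ENNReal.ofReal_le_ofReal
    have hd1 : (1 : ℝ) ≤ d := by exact_mod_cast hd
    set s : ℝ := d / 2 + 1 with hs
    have hs0 : 0 < s := by positivity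
    have hG := Real.Gamma_pos_of_pos hs0
    have hG' := Real.Gamma_pos_of_pos (by linarith : 0 < s + 1 / 2)
    have hle := Real.Gamma_add_half_le hs0
    have hpi3 := Real.pi_gt_three
    -- Squared, this reads `2d + 4 ≤ (d + 1)π`; for `d ≥ 1` the bound `π > 3` suffices.
    have hsq : 2 * √s ≤ √((d + 1 : ℕ) : ℝ) * √Real.pi := by
      rw [← Real.sqrt_mul (by positivity)]
      apply Real.le_sqrt_of_sq_le
      rw [mul_pow, Real.sq_sqrt hs0.le]
      push_cast
      nlinarith
    rw [show ((d + 1 : ℕ) : ℝ) / 2 + 1 = s + 1 / 2 by rw [hs]; push_cast; ring,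
      mul_div_assoc', mul_div_assoc', div_le_div_iff₀ hG hG', pow_succ]
    have hp : 0 ≤ √Real.pi ^ d := by positivity
    calc 2 * √Real.pi ^ d * Real.Gamma (s + 1 / 2)
        ≤ 2 * √Real.pi ^ d * (√s * Real.Gamma s) := by gcongr
      _ = √Real.pi ^ d * Real.Gamma s * (2 * √s) := by ring
      _ ≤ √Real.pi ^ d * Real.Gamma s * (√((d + 1 : ℕ) : ℝ) * √Real.pi) := by gcongr
      _ = _ := by ring

theorem exists_orthonormalBasis_zero_eq {d : ℕ} {v : EuclideanSpace ℝ (Fin (d + 1))}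
    (hv : ‖v‖ = 1) :
    ∃ b : OrthonormalBasis (Fin (d + 1)) ℝ (EuclideanSpace ℝ (Fin (d + 1))), b 0 = v := by
  have ho : Orthonormal ℝ (({0} : Set (Fin (d + 1))).domRestrict fun _ => v) := by
    refine ⟨fun i => by simpa using hv, fun i j hij => (hij (Subsingleton.elim i j)).elim⟩
  obtain ⟨b, hb⟩ := ho.exists_orthonormalBasis_extension_of_card_eq (by simp)
  exact ⟨b, hb 0 rfl⟩

/-- A measurable subset of the unit ball whose chords in the direction `v` have length at most `l`
has volume at most `l` times the volume of the unit ball of one dimension less. -/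
theorem volume_le_of_chord_le {d : ℕ} {v : EuclideanSpace ℝ (Fin (d + 1))} (hv : ‖v‖ = 1)
    {s : Set (EuclideanSpace ℝ (Fin (d + 1)))} (hs : MeasurableSet s)
    (hsub : s ⊆ Metric.closedBall 0 1) {l : ℝ}
    (hl : ∀ u ∈ s, ∀ a : ℝ, 0 ≤ a → u + a • v ∈ s → a ≤ l) :
    volume s ≤ ENNReal.ofReal l *
      volume (Metric.closedBall (0 : EuclideanSpace ℝ (Fin d)) 1) := by
  obtain ⟨b, hb⟩ := exists_orthonormalBasis_zero_eq hv
  -- Orthonormal coordinates with `v` as the axis of the first factor, so that Fubini slices `s`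
  -- into chords parallel to `v`.
  let g : ℝ × (Fin d → ℝ) → EuclideanSpace ℝ (Fin (d + 1)) := fun p =>
    b.repr.symm (WithLp.toLp 2 ((MeasurableEquiv.piFinSuccAbove (fun _ => ℝ) 0).symm p))
  have hg : MeasurePreserving g volume volume :=
    b.measurePreserving_repr_symm.comp ((PiLp.volume_preserving_toLp (Fin (d + 1))).comp
      (volume_preserving_piFinSuccAbove (fun _ => ℝ) 0).symm)
  have hnorm : ∀ a y, ‖g (a, y)‖ ^ 2 = a ^ 2 + ∑ i, y i ^ 2 := by
    intro a y
    simp only [g, LinearIsometryEquiv.norm_map, EuclideanSpace.norm_sq_eq, Real.norm_eq_abs,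
      sq_abs, Fin.sum_univ_succ]
    simp [MeasurableEquiv.piFinSuccAbove]
  have hadd : ∀ a c y, g (a + c, y) = g (a, y) + c • v := by
    intro a c y
    have : c • v = b.repr.symm (WithLp.toLp 2 (Pi.single 0 c)) := by
      rw [← hb, ← b.repr_symm_single, ← map_smul]
      congr 1
      ext i
      rcases eq_or_ne i 0 with rfl | hi <;> simp [*]
    rw [this]
    simp only [g]
    rw [← map_add]
    congr 1
    ext i
    refine Fin.cases ?_ (fun j => ?_) i <;> simp [MeasurableEquiv.piFinSuccAbove]
  have hball : (WithLp.ofLp ⁻¹' {y : Fin d → ℝ | ∑ i, y i ^ 2 ≤ 1}) =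
      Metric.closedBall (0 : EuclideanSpace ℝ (Fin d)) 1 := by
    ext y
    simp only [Set.mem_preimage, Set.mem_ofPred_eq, mem_closedBall_zero_iff]
    rw [← sq_le_one_iff₀ (norm_nonneg y), EuclideanSpace.norm_sq_eq]
    simp
  have hDm : MeasurableSet {y : Fin d → ℝ | ∑ i, y i ^ 2 ≤ 1} := by
    apply measurableSet_le <;> fun_prop
  rw [← hball, (PiLp.volume_preserving_ofLp (Fin d)).measure_preimage hDm.nullMeasurableSet,
    ← hg.measure_preimage hs.nullMeasurableSet, Measure.volume_eq_prod,
    Measure.prod_apply_symm (hg.measurable hs), ← setLIntegral_const,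
    ← lintegral_indicator hDm]
  apply lintegral_mono
  intro y
  by_cases hy : ∑ i, y i ^ 2 ≤ 1
  · rw [Set.indicator_of_mem (show y ∈ {y : Fin d → ℝ | ∑ i, y i ^ 2 ≤ 1} from hy)]
    refine (Real.volume_le_diam _).trans (Metric.ediam_le ?_)
    have key : ∀ a c : ℝ, g (a, y) ∈ s → g (c, y) ∈ s → a ≤ c → c - a ≤ l := by
      intro a c ha hc hac
      refine hl _ ha _ (by linarith) ?_
      rw [← hadd]
      simpa using hc
    intro a ha c hc
    rw [edist_dist, Real.dist_eq]
    apply ENNReal.ofReal_le_ofReal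
    rcases le_total a c with h | h
    · rw [abs_sub_comm, abs_of_nonneg (by linarith)]
      exact key a c ha hc h
    · rw [abs_of_nonneg (by linarith)]
      exact key c a hc ha h
  -- Lines whose foot `y` lies outside the lower-dimensional unit ball miss `s`.
  · have : ((fun a => (a, y)) ⁻¹' (g ⁻¹' s)) = ∅ := by
      ext a
      simp only [Set.mem_preimage, Set.mem_empty_iff_false, iff_false]
      intro ha
      have h1 := hsub ha
      rw [mem_closedBall_zero_iff, ← sq_le_one_iff₀ (norm_nonneg _), hnorm] at h1
      nlinarith [sq_nonneg a]
    simp [this]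

open ProbabilityTheory in
/-- If `h` grows at rate at least `κ` along the direction `v` inside the unit ball, then `|h|` is
small with small probability with respect to the uniform distribution on the ball. -/
theorem cond_closedBall_abs_le {m : ℕ} {v : EuclideanSpace ℝ (Fin m)} (hv : ‖v‖ = 1)
    {h : EuclideanSpace ℝ (Fin m) → ℝ} (hc : ContinuousOn h (Metric.closedBall 0 1)) {κ : ℝ}
    (hκ : 0 < κ)
    (hgrow : ∀ u ∈ Metric.closedBall (0 : EuclideanSpace ℝ (Fin m)) 1, ∀ a : ℝ, 0 ≤ a →
      u + a • v ∈ Metric.closedBall (0 : EuclideanSpace ℝ (Fin m)) 1 →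
        κ * a ≤ h (u + a • v) - h u) {t : ℝ} (ht : 0 ≤ t) :
    volume[|Metric.closedBall (0 : EuclideanSpace ℝ (Fin m)) 1] {u | |h u| ≤ t} ≤
      ENNReal.ofReal (√m / κ * t) := by
  obtain _ | d := m
  · simp [Subsingleton.elim v 0] at hv
  set B := Metric.closedBall (0 : EuclideanSpace ℝ (Fin (d + 1))) 1 with hB
  have hBm : MeasurableSet B := Metric.isClosed_closedBall.measurableSet
  have hB0 : volume B ≠ 0 := (Metric.measure_closedBall_pos _ _ one_pos).ne'
  have hBt : volume B ≠ ⊤ := measure_closedBall_lt_top.ne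
  have hclosed : IsClosed (B ∩ {u | |h u| ≤ t}) := by
    have := hc.abs.preimage_isClosed_of_isClosed Metric.isClosed_closedBall (isClosed_Iic (a := t))
    exact this
  rw [cond_apply hBm]
  have h1 : volume (B ∩ {u | |h u| ≤ t}) ≤ ENNReal.ofReal (2 * t / κ) *
      volume (Metric.closedBall (0 : EuclideanSpace ℝ (Fin d)) 1) := by
    -- Between two points with `|h| ≤ t`, `h` varies by at most `2t`; growth at rate `κ` then bounds
    -- the chord by `2t/κ`.
    refine volume_le_of_chord_le hv hclosed.measurableSet Set.inter_subset_left ?_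
    rintro u ⟨hu, hut⟩ a ha ⟨hua, huat⟩
    have := hgrow u hu a ha hua
    have e1 := abs_le.1 (show |h u| ≤ t from hut)
    have e2 := abs_le.1 (show |h (u + a • v)| ≤ t from huat)
    rw [le_div_iff₀ hκ]
    linarith [mul_comm κ a]
  have h2 : ENNReal.ofReal (2 * t / κ) = ENNReal.ofReal (t / κ) * 2 := by
    rw [show 2 * t / κ = t / κ * 2 by ring, ENNReal.ofReal_mul (by positivity)]
    simp
  calc (volume B)⁻¹ * volume (B ∩ {u | |h u| ≤ t})
      ≤ (volume B)⁻¹ * (ENNReal.ofReal (t / κ) *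
          (ENNReal.ofReal √((d + 1 : ℕ) : ℝ) * volume B)) := by
        gcongr
        refine h1.trans ?_
        rw [h2, mul_assoc]
        exact mul_le_mul_right (two_mul_volume_closedBall_le d) _
    _ = (ENNReal.ofReal (t / κ) * ENNReal.ofReal √((d + 1 : ℕ) : ℝ)) *
          ((volume B)⁻¹ * volume B) := by ring
    _ = ENNReal.ofReal (√((d + 1 : ℕ) : ℝ) / κ * t) := by
        rw [ENNReal.inv_mul_cancel hB0 hBt, mul_one, ← ENNReal.ofReal_mul (by positivity)]
        congr 1
        ring

/-! ### Expectations of variables with an exponential lower tail. -/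

section ExponentialTail

variable {Ω : Type*} [MeasurableSpace Ω] {μ : Measure Ω} {F : Ω → ℝ} {C : ℝ}

/-- Layer-cake formula: integrate the tail bound at `M + t` over `t > 0`. -/
theorem lintegral_ofReal_neg_sub_le_of_tail (hF : AEMeasurable F μ) (hC : 0 ≤ C)
    (htail : ∀ s : ℝ, μ {ω | F ω ≤ -s} ≤ ENNReal.ofReal (C * Real.exp (-s))) (M : ℝ) :
    ∫⁻ ω, ENNReal.ofReal (max (-M - F ω) 0) ∂μ ≤ ENNReal.ofReal (C * Real.exp (-M)) := by
  rw [lintegral_eq_lintegral_meas_le μ (ae_of_all _ fun ω => le_max_right (-M - F ω) 0)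
    ((aemeasurable_const.sub hF).max aemeasurable_const)]
  calc ∫⁻ t in Set.Ioi (0 : ℝ), μ {a | t ≤ max (-M - F a) 0}
      ≤ ∫⁻ t in Set.Ioi (0 : ℝ), ENNReal.ofReal (C * Real.exp (-M) * Real.exp (-t)) := by
        refine setLIntegral_mono' measurableSet_Ioi fun t ht => ?_
        have ht' : 0 < t := ht
        refine (measure_mono ?_).trans ((htail (M + t)).trans_eq ?_)
        · intro ω hω
          have : t ≤ max (-M - F ω) 0 := hω
          rcases le_max_iff.1 this with h | h
          · change F ω ≤ -(M + t)
            linarith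
          · linarith
        · rw [neg_add, Real.exp_add, mul_assoc]
    _ = ENNReal.ofReal (∫ t in Set.Ioi (0 : ℝ), C * Real.exp (-M) * Real.exp (-t)) := by
        rw [ofReal_integral_eq_lintegral_ofReal]
        · exact (integrableOn_exp_neg_Ioi 0).const_mul _
        · exact Eventually.of_forall fun t => by positivity
    _ = _ := by
        rw [integral_const_mul, integral_exp_neg_Ioi_zero, mul_one]

theorem integrable_neg_sub_of_tail (hF : AEStronglyMeasurable F μ) (hC : 0 ≤ C)
    (htail : ∀ s : ℝ, μ {ω | F ω ≤ -s} ≤ ENNReal.ofReal (C * Real.exp (-s))) (M : ℝ) :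
    Integrable (fun ω => max (-M - F ω) 0) μ := by
  refine ⟨(aestronglyMeasurable_const.sub hF).sup aestronglyMeasurable_const, ?_⟩
  rw [hasFiniteIntegral_iff_ofReal (ae_of_all _ fun ω => le_max_right (-M - F ω) 0)]
  exact (lintegral_ofReal_neg_sub_le_of_tail hF.aemeasurable hC htail M).trans_lt
    ENNReal.ofReal_lt_top

theorem integral_neg_sub_le_of_tail (hF : AEStronglyMeasurable F μ) (hC : 0 ≤ C)
    (htail : ∀ s : ℝ, μ {ω | F ω ≤ -s} ≤ ENNReal.ofReal (C * Real.exp (-s))) (M : ℝ) :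
    ∫ ω, max (-M - F ω) 0 ∂μ ≤ C * Real.exp (-M) := by
  rw [integral_eq_lintegral_of_nonneg_ae (ae_of_all _ fun ω => le_max_right (-M - F ω) 0)
    ((aestronglyMeasurable_const.sub hF).sup aestronglyMeasurable_const)]
  exact ENNReal.toReal_le_of_le_ofReal (by positivity)
    (lintegral_ofReal_neg_sub_le_of_tail hF.aemeasurable hC htail M)

variable [IsProbabilityMeasure μ]

theorem integrable_max_neg {K : ℝ} (hF : AEStronglyMeasurable F μ) (hK : ∀ᵐ ω ∂μ, F ω ≤ K)
    (M : ℝ) : Integrable (fun ω => max (F ω) (-M)) μ := by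
  refine Integrable.of_bound (hF.sup aestronglyMeasurable_const) (max |K| |M|) ?_
  filter_upwards [hK] with ω hω
  rw [Real.norm_eq_abs, abs_le]
  constructor
  · linarith [le_max_right |K| |M|, le_max_right (F ω) (-M), le_abs_self M]
  · refine max_le ?_ ?_
    · linarith [le_max_left |K| |M|, le_abs_self K]
    · linarith [le_max_right |K| |M|, neg_abs_le M]

theorem max_neg_sub_max_eq (a M : ℝ) : max a (-M) - max (-M - a) 0 = a := by
  rcases le_total a (-M) with h | h
  · rw [max_eq_right h, max_eq_left (by linarith)]
    ring
  · rw [max_eq_left h, max_eq_right (by linarith)]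
    ring

theorem integrable_of_tail {K : ℝ} (hF : AEStronglyMeasurable F μ) (hC : 0 ≤ C)
    (hK : ∀ᵐ ω ∂μ, F ω ≤ K)
    (htail : ∀ s : ℝ, μ {ω | F ω ≤ -s} ≤ ENNReal.ofReal (C * Real.exp (-s))) :
    Integrable F μ := by
  refine ((integrable_max_neg hF hK 0).sub (integrable_neg_sub_of_tail hF hC htail 0)).congr ?_
  exact Eventually.of_forall fun ω => max_neg_sub_max_eq _ _

/-- Splits off a bounded truncation; the remaining term has expectation at most `C exp (-M)`,
whatever `F` is. -/
theorem integral_eq_integral_max_sub {K : ℝ} (hF : AEStronglyMeasurable F μ) (hC : 0 ≤ C)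
    (hK : ∀ᵐ ω ∂μ, F ω ≤ K)
    (htail : ∀ s : ℝ, μ {ω | F ω ≤ -s} ≤ ENNReal.ofReal (C * Real.exp (-s))) (M : ℝ) :
    ∫ ω, F ω ∂μ = ∫ ω, max (F ω) (-M) ∂μ - ∫ ω, max (-M - F ω) 0 ∂μ := by
  rw [← integral_sub (integrable_max_neg hF hK M) (integrable_neg_sub_of_tail hF hC htail M)]
  simp only [max_neg_sub_max_eq]

/-- A random variable whose lower tail is dominated by `C exp (-s)` has expectation at least
`-log C - 1`. -/
theorem neg_log_sub_one_le_integral {K : ℝ} (hF : AEStronglyMeasurable F μ) (hC : 0 < C)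
    (hK : ∀ᵐ ω ∂μ, F ω ≤ K)
    (htail : ∀ s : ℝ, μ {ω | F ω ≤ -s} ≤ ENNReal.ofReal (C * Real.exp (-s))) :
    -Real.log C - 1 ≤ ∫ ω, F ω ∂μ := by
  -- At the level `M = log C` the remainder bound `C exp (-M)` equals `1`.
  rw [integral_eq_integral_max_sub hF hC.le hK htail (Real.log C)]
  have h1 := integral_neg_sub_le_of_tail hF hC.le htail (Real.log C)
  rw [Real.exp_neg, Real.exp_log hC, mul_inv_cancel₀ hC.ne'] at h1
  have h2 : ∫ _, -Real.log C ∂μ ≤ ∫ ω, max (F ω) (-Real.log C) ∂μ :=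
    integral_mono (integrable_const _) (integrable_max_neg hF hK _) fun ω => le_max_right _ _
  simp only [integral_const, probReal_univ, one_smul] at h2
  linarith

/-- Convergence of expectations under a uniform upper bound and a uniform exponential lower
tail. -/
theorem tendsto_integral_of_tail {ι : Type*} {l : Filter ι} [l.IsCountablyGenerated]
    {G : ι → Ω → ℝ} {K : ℝ} (hC : 0 ≤ C)
    (hG : ∀ᶠ i in l, AEStronglyMeasurable (G i) μ) (hF : AEStronglyMeasurable F μ)
    (hGK : ∀ᶠ i in l, ∀ᵐ ω ∂μ, G i ω ≤ K) (hFK : ∀ᵐ ω ∂μ, F ω ≤ K)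
    (hGtail : ∀ᶠ i in l, ∀ s : ℝ, μ {ω | G i ω ≤ -s} ≤ ENNReal.ofReal (C * Real.exp (-s)))
    (hFtail : ∀ s : ℝ, μ {ω | F ω ≤ -s} ≤ ENNReal.ofReal (C * Real.exp (-s)))
    (hlim : ∀ᵐ ω ∂μ, Tendsto (fun i => G i ω) l (𝓝 (F ω))) :
    Tendsto (fun i => ∫ ω, G i ω ∂μ) l (𝓝 (∫ ω, F ω ∂μ)) := by
  rw [Metric.tendsto_nhds]
  intro ε hε
  -- One truncation level serves all `i`, since the tail constant is uniform; the truncated parts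
  -- converge by dominated convergence.
  obtain ⟨M, hM⟩ : ∃ M : ℝ, C * Real.exp (-M) < ε / 2 := by
    have : Tendsto (fun M : ℝ => C * Real.exp (-M)) atTop (𝓝 (C * 0)) :=
      (Real.tendsto_exp_neg_atTop_nhds_zero).const_mul C
    rw [mul_zero] at this
    exact (this.eventually_lt_const (by linarith)).exists
  have hmax : Tendsto (fun i => ∫ ω, max (G i ω) (-M) ∂μ) l (𝓝 (∫ ω, max (F ω) (-M) ∂μ)) := by
    refine tendsto_integral_filter_of_dominated_convergence (fun _ => max |K| |M|) ?_ ?_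
      (integrable_const _) ?_
    · filter_upwards [hG] with i hi using hi.sup aestronglyMeasurable_const
    · filter_upwards [hGK] with i hi
      filter_upwards [hi] with ω hω
      rw [Real.norm_eq_abs, abs_le]
      constructor
      · linarith [le_max_right |K| |M|, le_max_right (G i ω) (-M), le_abs_self M]
      · refine max_le ?_ ?_
        · linarith [le_max_left |K| |M|, le_abs_self K]
        · linarith [le_max_right |K| |M|, neg_abs_le M]
    · filter_upwards [hlim] with ω hω using hω.max tendsto_const_nhds
  filter_upwards [hG, hGK, hGtail, Metric.tendsto_nhds.1 hmax (ε / 2) (by linarith)]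
    with i h1 h2 h3 h4
  rw [Real.dist_eq, abs_lt] at h4 ⊢
  rw [integral_eq_integral_max_sub h1 hC h2 h3 M, integral_eq_integral_max_sub hF hC hFK hFtail M]
  have a1 := integral_neg_sub_le_of_tail h1 hC h3 M
  have a2 := integral_neg_sub_le_of_tail hF hC hFtail M
  have a3 : 0 ≤ ∫ ω, max (-M - G i ω) 0 ∂μ := integral_nonneg fun ω => le_max_right _ _
  have a4 : 0 ≤ ∫ ω, max (-M - F ω) 0 ∂μ := integral_nonneg fun ω => le_max_right _ _
  constructor <;> linarith [h4.1, h4.2]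

end ExponentialTail

/-! ### Moments of the uniform distribution on the unit ball. -/

section UnitBall

open ProbabilityTheory

instance isProbabilityMeasure_cond_closedBall {m : ℕ} :
    IsProbabilityMeasure (volume[|Metric.closedBall (0 : EuclideanSpace ℝ (Fin m)) 1]) :=
  cond_isProbabilityMeasure_of_finite (Metric.measure_closedBall_pos _ _ one_pos).ne'
    measure_closedBall_lt_top.ne

theorem ae_cond_closedBall_norm_le {m : ℕ} :
    ∀ᵐ u ∂volume[|Metric.closedBall (0 : EuclideanSpace ℝ (Fin m)) 1], ‖u‖ ≤ 1 := by
  filter_upwards [ae_cond_mem (μ := volume)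
    (Metric.isClosed_closedBall (x := (0 : EuclideanSpace ℝ (Fin m))) (ε := 1)).measurableSet]
    with u hu
  simpa using hu

theorem ContinuousOn.aestronglyMeasurable_cond_closedBall {m : ℕ}
    {g : EuclideanSpace ℝ (Fin m) → ℝ} (hg : ContinuousOn g (Metric.closedBall 0 1)) :
    AEStronglyMeasurable g (volume[|Metric.closedBall (0 : EuclideanSpace ℝ (Fin m)) 1]) :=
  (hg.aestronglyMeasurable Metric.isClosed_closedBall.measurableSet).smul_measure _

theorem ContinuousOn.integrable_cond_closedBall {m : ℕ}
    {g : EuclideanSpace ℝ (Fin m) → ℝ} (hg : ContinuousOn g (Metric.closedBall 0 1)) :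
    Integrable g (volume[|Metric.closedBall (0 : EuclideanSpace ℝ (Fin m)) 1]) :=
  Integrable.smul_measure (hg.integrableOn_compact (isCompact_closedBall 0 1))
    (ENNReal.inv_ne_top.2 (Metric.measure_closedBall_pos _ _ one_pos).ne')

/-- The uniform distribution on the unit ball is invariant under linear isometries. -/
theorem LinearIsometryEquiv.measurePreserving_cond_closedBall {m : ℕ}
    (e : EuclideanSpace ℝ (Fin m) ≃ₗᵢ[ℝ] EuclideanSpace ℝ (Fin m)) :
    MeasurePreserving e (volume[|Metric.closedBall (0 : EuclideanSpace ℝ (Fin m)) 1])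
      (volume[|Metric.closedBall (0 : EuclideanSpace ℝ (Fin m)) 1]) := by
  have h := e.measurePreserving.restrict_preimage
    (Metric.isClosed_closedBall (x := (0 : EuclideanSpace ℝ (Fin m))) (ε := 1)).measurableSet
  have hp : e ⁻¹' Metric.closedBall (0 : EuclideanSpace ℝ (Fin m)) 1 = Metric.closedBall 0 1 := by
    ext u
    simp
  rw [hp] at h
  exact h.smul_measure _

/-- Polar coordinates: the radial integral is that of `r ^ (m + 1)` over `[0, 1]`. -/
theorem integral_norm_sq_cond_closedBall {m : ℕ} (hm : 0 < m) :
    ∫ u, ‖u‖ ^ 2 ∂volume[|Metric.closedBall (0 : EuclideanSpace ℝ (Fin m)) 1] = m / (m + 2) := by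
  have : Nonempty (Fin m) := ⟨⟨0, hm⟩⟩
  set B := Metric.closedBall (0 : EuclideanSpace ℝ (Fin m)) 1 with hB
  have hBm : MeasurableSet B := Metric.isClosed_closedBall.measurableSet
  have hB0 : volume B ≠ 0 := (Metric.measure_closedBall_pos _ _ one_pos).ne'
  have hBt : volume B ≠ ⊤ := measure_closedBall_lt_top.ne
  have hpos : 0 < volume.real B := ENNReal.toReal_pos hB0 hBt
  have hball : volume.real (Metric.ball (0 : EuclideanSpace ℝ (Fin m)) 1) = volume.real B := by
    simp only [Measure.real, hB]
    rw [Measure.addHaar_closedBall_eq_addHaar_ball]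
  have h1 : ∫ u in B, ‖u‖ ^ 2 = m / (m + 2) * volume.real B := by
    have e1 : ∫ u in B, ‖u‖ ^ 2 =
        ∫ u : EuclideanSpace ℝ (Fin m), (Set.Iic (1 : ℝ)).indicator (fun t => t ^ 2) ‖u‖ := by
      rw [← integral_indicator hBm]
      congr 1
      ext u
      by_cases hu : ‖u‖ ≤ 1
      · rw [Set.indicator_of_mem (by simpa [hB] using hu), Set.indicator_of_mem (by simpa using hu)]
      · rw [Set.indicator_of_notMem (by simpa [hB] using hu),
          Set.indicator_of_notMem (by simpa using hu)]
    rw [e1, integral_fun_norm_addHaar volume ((Set.Iic (1 : ℝ)).indicator (fun t => t ^ 2)), hball]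
    have e2 : ∫ y in Set.Ioi (0 : ℝ), y ^ (Module.finrank ℝ (EuclideanSpace ℝ (Fin m)) - 1) •
        (Set.Iic (1 : ℝ)).indicator (fun t => t ^ 2) y = ∫ y in (0 : ℝ)..1, y ^ (m + 1) := by
      rw [intervalIntegral.integral_of_le zero_le_one, ← Set.Ioi_inter_Iic,
        ← setIntegral_indicator measurableSet_Iic]
      congr 1
      ext y
      rw [finrank_euclideanSpace_fin]
      by_cases hy : y ∈ Set.Iic (1 : ℝ)
      · rw [Set.indicator_of_mem hy, Set.indicator_of_mem hy, smul_eq_mul, ← pow_add]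
        congr 1
        omega
      · rw [Set.indicator_of_notMem hy, Set.indicator_of_notMem hy, smul_zero]
    rw [e2, integral_pow, finrank_euclideanSpace_fin]
    simp only [nsmul_eq_mul, smul_eq_mul, one_pow]
    push_cast
    rw [zero_pow (by omega)]
    ring
  rw [ProbabilityTheory.cond, integral_smul_measure, h1, ENNReal.toReal_inv, smul_eq_mul]
  change (volume.real B)⁻¹ * _ = _
  field_simp

/-- By rotation invariance the second moment depends only on `‖a‖`, and over the `m` coordinate
vectors it sums to `E‖u‖²`. -/
theorem integral_inner_sq_cond_closedBall {m : ℕ} (hm : 0 < m) (a : EuclideanSpace ℝ (Fin m)) :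
    ∫ u, (inner ℝ a u) ^ 2 ∂volume[|Metric.closedBall (0 : EuclideanSpace ℝ (Fin m)) 1] =
      ‖a‖ ^ 2 / (m + 2) := by
  set μ := volume[|Metric.closedBall (0 : EuclideanSpace ℝ (Fin m)) 1] with hμ
  have hint : ∀ c : EuclideanSpace ℝ (Fin m), Integrable (fun u => (inner ℝ c u : ℝ) ^ 2) μ :=
    fun c => ContinuousOn.integrable_cond_closedBall (by fun_prop)
  have hrot : ∀ b c : EuclideanSpace ℝ (Fin m), ‖b‖ = ‖c‖ →
      ∫ u, (inner ℝ b u : ℝ) ^ 2 ∂μ = ∫ u, (inner ℝ c u : ℝ) ^ 2 ∂μ := by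
    -- Reflection in the hyperplane orthogonal to `b - c` sends `b` to `c`, as the norms agree.
    intro b c hbc
    set e := (Submodule.span ℝ {b - c})ᗮ.reflection with he
    have hec : e b = c := Submodule.reflection_sub hbc
    rw [← (LinearIsometryEquiv.measurePreserving_cond_closedBall e).integral_comp
      e.toHomeomorph.measurableEmbedding (fun u => (inner ℝ c u : ℝ) ^ 2)]
    congr 1
    ext u
    rw [← hec, e.inner_map_map]
  have hscale : ∀ i, ∫ u, (inner ℝ a u : ℝ) ^ 2 ∂μ =
      ‖a‖ ^ 2 * ∫ u, (inner ℝ (EuclideanSpace.single i (1 : ℝ)) u : ℝ) ^ 2 ∂μ := by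
    intro i
    rw [hrot a (‖a‖ • EuclideanSpace.single i (1 : ℝ)) (by simp [norm_smul]),
      ← integral_const_mul]
    congr 1
    ext u
    rw [inner_smul_left]
    simp [mul_pow]
  have hsum : ∑ i : Fin m, ∫ u, (inner ℝ (EuclideanSpace.single i (1 : ℝ)) u : ℝ) ^ 2 ∂μ =
      m / (m + 2) := by
    rw [← integral_norm_sq_cond_closedBall hm, ← integral_finsetSum _ fun i _ => hint _]
    congr 1
    ext u
    rw [EuclideanSpace.norm_sq_eq]
    simp [EuclideanSpace.inner_single_left]
  have hm' : (0 : ℝ) < m := by exact_mod_cast hm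
  have h : (m : ℝ) * ∫ u, (inner ℝ a u : ℝ) ^ 2 ∂μ = ‖a‖ ^ 2 * (m / (m + 2)) := by
    rw [← hsum, Finset.mul_sum, ← Finset.sum_congr rfl fun i _ => hscale i]
    simp
  have : (0 : ℝ) < m + 2 := by positivity
  field_simp at h ⊢
  linarith

/-- The second moment of `‖A u‖` for `u` uniform in the unit ball. -/
theorem integral_norm_map_sq_le {m n : ℕ} (hm : 0 < m)
    (A : EuclideanSpace ℝ (Fin m) →L[ℝ] EuclideanSpace ℝ (Fin n)) :
    ∫ u, ‖A u‖ ^ 2 ∂volume[|Metric.closedBall (0 : EuclideanSpace ℝ (Fin m)) 1] ≤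
      ‖A‖ ^ 2 * (((min m n : ℕ) : ℝ) / (m + 2)) := by
  set μ := volume[|Metric.closedBall (0 : EuclideanSpace ℝ (Fin m)) 1] with hμ
  -- For `m ≤ n` the pointwise bound `‖A u‖ ≤ ‖A‖ ‖u‖` is enough. For `n ≤ m`, `‖A u‖²` is a sum
  -- over the `n` rows of `A`, each of norm at most `‖A‖`.
  rcases le_total m n with h | h
  · rw [min_eq_left h, ← integral_norm_sq_cond_closedBall hm, ← integral_const_mul]
    refine integral_mono (ContinuousOn.integrable_cond_closedBall (by fun_prop))
      (ContinuousOn.integrable_cond_closedBall (by fun_prop)) fun u => ?_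
    change ‖A u‖ ^ 2 ≤ ‖A‖ ^ 2 * ‖u‖ ^ 2
    rw [← mul_pow]
    gcongr
    exact A.le_opNorm u
  · rw [min_eq_right h]
    have e1 : ∀ u, ‖A u‖ ^ 2 = ∑ j : Fin n,
        (inner ℝ (A.adjoint (EuclideanSpace.single j (1 : ℝ))) u : ℝ) ^ 2 := by
      intro u
      rw [EuclideanSpace.norm_sq_eq]
      refine Finset.sum_congr rfl fun j _ => ?_
      rw [ContinuousLinearMap.adjoint_inner_left, EuclideanSpace.inner_single_left]
      simp
    simp only [e1]
    rw [integral_finsetSum _ fun j _ => ContinuousOn.integrable_cond_closedBall (by fun_prop)]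
    simp only [integral_inner_sq_cond_closedBall hm]
    calc ∑ j : Fin n, ‖A.adjoint (EuclideanSpace.single j (1 : ℝ))‖ ^ 2 / ((m : ℝ) + 2)
        ≤ ∑ _j : Fin n, ‖A‖ ^ 2 / ((m : ℝ) + 2) := by
          refine Finset.sum_le_sum fun j _ => ?_
          gcongr
          have := A.adjoint.le_opNorm (EuclideanSpace.single j (1 : ℝ))
          simpa using this
      _ = _ := by
          simp
          ring

/-- The variance of `‖A u‖` is nonnegative, so the mean is controlled by the second moment. -/
theorem integral_norm_map_le {m n : ℕ} (hm : 0 < m)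
    (A : EuclideanSpace ℝ (Fin m) →L[ℝ] EuclideanSpace ℝ (Fin n)) :
    ∫ u, ‖A u‖ ∂volume[|Metric.closedBall (0 : EuclideanSpace ℝ (Fin m)) 1] ≤
      ‖A‖ * √(((min m n : ℕ) : ℝ) / (m + 2)) := by
  set μ := volume[|Metric.closedBall (0 : EuclideanSpace ℝ (Fin m)) 1] with hμ
  have h1 : Integrable (fun u => ‖A u‖) μ := ContinuousOn.integrable_cond_closedBall (by fun_prop)
  have h2 : Integrable (fun u => ‖A u‖ ^ 2) μ :=
    ContinuousOn.integrable_cond_closedBall (by fun_prop)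
  set a := ∫ u, ‖A u‖ ∂μ with ha
  have h3 : 0 ≤ ∫ u, (‖A u‖ - a) ^ 2 ∂μ := integral_nonneg fun u => sq_nonneg _
  have h4 : ∫ u, (‖A u‖ - a) ^ 2 ∂μ = ∫ u, ‖A u‖ ^ 2 ∂μ - a ^ 2 := by
    have : ∀ u, (‖A u‖ - a) ^ 2 = ‖A u‖ ^ 2 - 2 * a * ‖A u‖ + a ^ 2 := fun u => by ring
    simp only [this]
    have h1' : Integrable (fun u => 2 * a * ‖A u‖) μ := h1.const_mul _
    have h21 : Integrable (fun u => ‖A u‖ ^ 2 - 2 * a * ‖A u‖) μ := h2.sub h1'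
    rw [integral_add h21 (integrable_const _), integral_sub h2 h1', integral_const_mul, ← ha]
    simp
    ring
  have h5 := integral_norm_map_sq_le hm A
  rw [← Real.sqrt_sq (norm_nonneg A), ← Real.sqrt_mul (sq_nonneg _)]
  apply Real.le_sqrt_of_sq_le
  linarith

end UnitBall

/-! ### Top singular vectors. -/

/-- Operators between Euclidean spaces have a singular pair for the operator norm. -/
theorem exists_top_singular_pair {m n : ℕ}
    (A : EuclideanSpace ℝ (Fin m) →L[ℝ] EuclideanSpace ℝ (Fin n)) (hA : A ≠ 0) :
    ∃ (v : EuclideanSpace ℝ (Fin m)) (w : EuclideanSpace ℝ (Fin n)), ‖v‖ = 1 ∧ ‖w‖ = 1 ∧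
      ∀ u, inner ℝ w (A u) = ‖A‖ * inner ℝ v u := by
  have hA' : 0 < ‖A‖ := norm_pos_iff.2 hA
  have : Nontrivial (EuclideanSpace ℝ (Fin m)) := by
    by_contra h
    rw [not_nontrivial_iff_subsingleton] at h
    exact hA (Subsingleton.elim _ _)
  obtain ⟨v, hv, hmax⟩ := (isCompact_sphere (0 : EuclideanSpace ℝ (Fin m)) 1).exists_isMaxOn
    (NormedSpace.sphere_nonempty.2 zero_le_one) (f := fun u => ‖A u‖) (by fun_prop)
  have hv1 : ‖v‖ = 1 := by simpa using hv
  have hAv : ‖A v‖ = ‖A‖ := by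
    refine le_antisymm (by simpa [hv1] using A.le_opNorm v) ?_
    refine A.opNorm_le_bound (norm_nonneg _) fun u => ?_
    rcases eq_or_ne u 0 with rfl | hu
    · simp
    have hu' : 0 < ‖u‖ := norm_pos_iff.2 hu
    have := hmax (show ‖u‖⁻¹ • u ∈ Metric.sphere (0 : EuclideanSpace ℝ (Fin m)) 1 by
      simp [norm_smul, hu'.ne'])
    simp only [Set.mem_ofPred_eq, map_smul, norm_smul, norm_inv, norm_norm] at this
    rwa [inv_mul_le_iff₀ hu', mul_comm] at this
  have hw1 : ‖‖A‖⁻¹ • A v‖ = 1 := by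
    rw [norm_smul, hAv, norm_inv, norm_norm, inv_mul_cancel₀ hA'.ne']
  refine ⟨v, ‖A‖⁻¹ • A v, hv1, hw1, fun u => ?_⟩
  set w := ‖A‖⁻¹ • A v with hw
  have hin : (inner ℝ (A.adjoint w) v : ℝ) = ‖A‖ := by
    rw [ContinuousLinearMap.adjoint_inner_left, hw, inner_smul_left, real_inner_self_eq_norm_sq, hAv]
    simp
    field_simp
  have hle : ‖A.adjoint w‖ ≤ ‖A‖ := by
    simpa [hw1] using A.adjoint.le_opNorm w
  -- Equality case of Cauchy–Schwarz: the adjoint image of `w` has norm at most `‖A‖` and inner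
  -- product exactly `‖A‖` with the unit vector `v`.
  have heq : A.adjoint w = ‖A‖ • v := by
    rw [← sub_eq_zero, ← norm_eq_zero, ← sq_eq_zero_iff]
    refine le_antisymm ?_ (sq_nonneg _)
    rw [norm_sub_sq_real, inner_smul_right, hin, norm_smul, hv1]
    simp only [norm_norm, mul_one]
    nlinarith [norm_nonneg (A.adjoint w)]
  rw [← ContinuousLinearMap.adjoint_inner_left, heq, inner_smul_left]
  simp

/-! ### Rescaling the perturbation set to the unit ball. -/

-- The Jacobian `ρ ^ m` cancels on normalising. Averages over all perturbation sets thus become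
-- integrals against one probability measure independent of `δ`.
open ProbabilityTheory Pointwise in
theorem measurePreserving_cond_closedBall {m : ℕ} (x : EuclideanSpace ℝ (Fin m)) {ρ : ℝ}
    (hρ : 0 < ρ) :
    MeasurePreserving (fun u : EuclideanSpace ℝ (Fin m) => x + ρ • u)
      (volume[|Metric.closedBall (0 : EuclideanSpace ℝ (Fin m)) 1])
      (volume[|Metric.closedBall x ρ]) := by
  have hmeas : Measurable fun u : EuclideanSpace ℝ (Fin m) => x + ρ • u := by fun_prop
  have himage : ∀ t : Set (EuclideanSpace ℝ (Fin m)),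
      volume ((fun u => x + ρ • u) '' t) = ENNReal.ofReal (ρ ^ m) * volume t := by
    intro t
    have : (fun u => x + ρ • u) '' t = x +ᵥ (ρ • t) := by
      rw [← Set.image_smul, ← Set.image_vadd, Set.image_image]
      rfl
    rw [this, measure_vadd, Measure.addHaar_smul, finrank_euclideanSpace_fin,
      abs_of_pos (by positivity)]
  have hsurj : ∀ y, y ∈ Metric.closedBall x ρ →
      ∃ u ∈ Metric.closedBall (0 : EuclideanSpace ℝ (Fin m)) 1, x + ρ • u = y := by
    intro y hy
    refine ⟨ρ⁻¹ • (y - x), ?_, ?_⟩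
    · rw [mem_closedBall_iff_norm] at hy
      rw [mem_closedBall_zero_iff, norm_smul, norm_inv, Real.norm_of_nonneg hρ.le,
        inv_mul_le_iff₀ hρ, mul_one]
      exact hy
    · rw [smul_inv_smul₀ hρ.ne']
      abel
  have hmaps : ∀ u ∈ Metric.closedBall (0 : EuclideanSpace ℝ (Fin m)) 1,
      x + ρ • u ∈ Metric.closedBall x ρ := by
    intro u hu
    rw [mem_closedBall_zero_iff] at hu
    rw [mem_closedBall_iff_norm, add_sub_cancel_left, norm_smul, Real.norm_of_nonneg hρ.le]
    nlinarith
  have hset : ∀ t : Set (EuclideanSpace ℝ (Fin m)), Metric.closedBall x ρ ∩ t =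
      (fun u => x + ρ • u) '' (Metric.closedBall 0 1 ∩ (fun u => x + ρ • u) ⁻¹' t) := by
    intro t
    ext y
    constructor
    · rintro ⟨hy, hyt⟩
      obtain ⟨u, hu, rfl⟩ := hsurj y hy
      exact ⟨u, ⟨hu, hyt⟩, rfl⟩
    · rintro ⟨u, ⟨hu, hut⟩, rfl⟩
      exact ⟨hmaps u hu, hut⟩
  have hvol : volume (Metric.closedBall x ρ) = ENNReal.ofReal (ρ ^ m) *
      volume (Metric.closedBall (0 : EuclideanSpace ℝ (Fin m)) 1) := by
    rw [← himage]
    congr 1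
    simpa using hset Set.univ
  have hc0 : ENNReal.ofReal (ρ ^ m) ≠ 0 := by
    simpa using pow_pos hρ m
  refine ⟨hmeas, Measure.ext fun t ht => ?_⟩
  rw [Measure.map_apply hmeas ht, cond_apply Metric.isClosed_closedBall.measurableSet,
    cond_apply Metric.isClosed_closedBall.measurableSet, hset t, himage, hvol,
    ENNReal.mul_inv (Or.inl hc0) (Or.inl ENNReal.ofReal_ne_top), mul_mul_mul_comm,
    ENNReal.inv_mul_cancel hc0 ENNReal.ofReal_ne_top, one_mul]

section PerturbationSet

open ProbabilityTheory

variable {m : ℕ} {x : EuclideanSpace ℝ (Fin m)} {δ : ℝ}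

theorem perturbationSet_eq_closedBall (x : EuclideanSpace ℝ (Fin m)) (δ : ℝ) :
    perturbationSet x δ = Metric.closedBall x (δ * ‖x‖) := by
  ext y
  rw [mem_closedBall_iff_norm]
  rfl

theorem perturbationSet_eq_image (hx : x ≠ 0) (hδ : 0 < δ) :
    perturbationSet x δ = (fun u => x + (δ * ‖x‖) • u) '' Metric.closedBall 0 1 := by
  have hρ : 0 < δ * ‖x‖ := mul_pos hδ (norm_pos_iff.2 hx)
  have := (affinity_unitClosedBall hρ.le x).symm
  rw [perturbationSet_eq_closedBall, this, ← Set.image_smul, ← Set.image_vadd, Set.image_image]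
  rfl

theorem measurableEmbedding_add_smul (x : EuclideanSpace ℝ (Fin m)) {ρ : ℝ} (hρ : ρ ≠ 0) :
    MeasurableEmbedding fun u : EuclideanSpace ℝ (Fin m) => x + ρ • u :=
  ((Homeomorph.smulOfNeZero ρ hρ).trans (Homeomorph.addLeft x)).measurableEmbedding

theorem setAverage_perturbationSet (hx : x ≠ 0) (hδ : 0 < δ) (g : EuclideanSpace ℝ (Fin m) → ℝ) :
    ⨍ y in perturbationSet x δ, g y =
      ∫ u, g (x + (δ * ‖x‖) • u) ∂volume[|Metric.closedBall (0 : EuclideanSpace ℝ (Fin m)) 1] := by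
  have hρ : 0 < δ * ‖x‖ := mul_pos hδ (norm_pos_iff.2 hx)
  rw [perturbationSet_eq_closedBall, setAverage_eq', (measurePreserving_cond_closedBall x
    hρ).integral_comp (measurableEmbedding_add_smul x hρ.ne') g]
  rfl

theorem integrableOn_perturbationSet_iff (hx : x ≠ 0) (hδ : 0 < δ)
    (g : EuclideanSpace ℝ (Fin m) → ℝ) :
    IntegrableOn g (perturbationSet x δ) volume ↔
      Integrable (fun u => g (x + (δ * ‖x‖) • u))
        (volume[|Metric.closedBall (0 : EuclideanSpace ℝ (Fin m)) 1]) := by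
  have hρ : 0 < δ * ‖x‖ := mul_pos hδ (norm_pos_iff.2 hx)
  have h := (measurePreserving_cond_closedBall x hρ).integrable_comp_emb
    (measurableEmbedding_add_smul x hρ.ne') (g := g)
  rw [perturbationSet_eq_closedBall]
  refine Iff.trans ?_ h.symm
  exact (integrable_smul_measure (ENNReal.inv_ne_zero.2 measure_closedBall_lt_top.ne)
    (ENNReal.inv_ne_top.2 (Metric.measure_closedBall_pos _ _ hρ).ne')).symm

theorem ae_restrict_perturbationSet_iff (hx : x ≠ 0) (hδ : 0 < δ)
    (p : EuclideanSpace ℝ (Fin m) → Prop) :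
    (∀ᵐ y ∂(volume.restrict (perturbationSet x δ)), p y) ↔
      ∀ᵐ u ∂volume[|Metric.closedBall (0 : EuclideanSpace ℝ (Fin m)) 1],
        p (x + (δ * ‖x‖) • u) := by
  have hρ : 0 < δ * ‖x‖ := mul_pos hδ (norm_pos_iff.2 hx)
  rw [← (measurableEmbedding_add_smul x hρ.ne').ae_map_iff,
    (measurePreserving_cond_closedBall x hρ).map_eq, perturbationSet_eq_closedBall]
  exact (Measure.ae_ennreal_smul_measure_iff
    (ENNReal.inv_ne_zero.2 measure_closedBall_lt_top.ne)).symm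

theorem eventually_forall_add_smul (x : EuclideanSpace ℝ (Fin m))
    {p : EuclideanSpace ℝ (Fin m) → Prop} (hp : ∀ᶠ y in 𝓝 x, p y) :
    ∀ᶠ δ in 𝓝[>] (0 : ℝ), ∀ u : EuclideanSpace ℝ (Fin m), ‖u‖ ≤ 1 →
      p (x + (δ * ‖x‖) • u) := by
  obtain ⟨ε, hε, h⟩ := Metric.eventually_nhds_iff.1 hp
  have hlim : Tendsto (fun δ : ℝ => δ * ‖x‖) (𝓝[>] 0) (𝓝 0) := by
    have : Tendsto (fun δ : ℝ => δ * ‖x‖) (𝓝 0) (𝓝 (0 * ‖x‖)) := tendsto_id.mul_const _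
    rw [zero_mul] at this
    exact this.mono_left nhdsWithin_le_nhds
  filter_upwards [hlim.eventually_lt_const hε, self_mem_nhdsWithin] with δ h1 h2 u hu
  have h2' : 0 < δ := h2
  have h3 : 0 ≤ δ * ‖x‖ := by positivity
  apply h
  rw [dist_eq_norm, add_sub_cancel_left, norm_smul, Real.norm_of_nonneg h3]
  nlinarith

end PerturbationSet

/-! ### Limits of the error quotients: WNC and SNC. -/

section ErrorQuotient

open ProbabilityTheory

variable {m n : ℕ} {f : EuclideanSpace ℝ (Fin m) → EuclideanSpace ℝ (Fin n)}
  {x : EuclideanSpace ℝ (Fin m)}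

/-- The rescaled error quotients converge uniformly on the unit ball. -/
theorem eventually_abs_errorQuotient_sub_le
    {A : EuclideanSpace ℝ (Fin m) →L[ℝ] EuclideanSpace ℝ (Fin n)} (hf : HasFDerivAt f A x)
    (hx : x ≠ 0) (hfx : f x ≠ 0) {ε : ℝ} (hε : 0 < ε) :
    ∀ᶠ δ in 𝓝[>] (0 : ℝ), ∀ u : EuclideanSpace ℝ (Fin m), ‖u‖ ≤ 1 →
      |errorQuotient f x δ (x + (δ * ‖x‖) • u) - ‖x‖ / ‖f x‖ * ‖A u‖| ≤ ε := by
  have hx' : 0 < ‖x‖ := norm_pos_iff.2 hx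
  have hfx' : 0 < ‖f x‖ := norm_pos_iff.2 hfx
  have h := (hasFDerivAt_iff_isLittleO.1 hf).def (show 0 < ε * ‖f x‖ / ‖x‖ by positivity)
  filter_upwards [eventually_forall_add_smul x h, self_mem_nhdsWithin] with δ h1 hδ u hu
  have hδ' : 0 < δ := hδ
  have h2 := h1 u hu
  have h3 : 0 < δ * ‖x‖ := by positivity
  rw [add_sub_cancel_left, map_smul, norm_smul, Real.norm_of_nonneg h3.le] at h2
  have h4 := (abs_norm_sub_norm_le _ _).trans h2
  rw [norm_smul, Real.norm_of_nonneg h3.le] at h4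
  have h5 : errorQuotient f x δ (x + (δ * ‖x‖) • u) - ‖x‖ / ‖f x‖ * ‖A u‖ =
      (‖f (x + (δ * ‖x‖) • u) - f x‖ - δ * ‖x‖ * ‖A u‖) / (δ * ‖f x‖) := by
    unfold errorQuotient
    field_simp
  rw [h5, abs_div, abs_of_pos (show 0 < δ * ‖f x‖ by positivity), div_le_iff₀ (by positivity)]
  refine h4.trans ?_
  calc ε * ‖f x‖ / ‖x‖ * (δ * ‖x‖ * ‖u‖) = ε * (δ * ‖f x‖) * ‖u‖ := by field_simp
    _ ≤ ε * (δ * ‖f x‖) * 1 := by gcongr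
    _ = _ := mul_one _

theorem tendsto_errorQuotient
    {A : EuclideanSpace ℝ (Fin m) →L[ℝ] EuclideanSpace ℝ (Fin n)} (hf : HasFDerivAt f A x)
    (hx : x ≠ 0) (hfx : f x ≠ 0) {u : EuclideanSpace ℝ (Fin m)} (hu : ‖u‖ ≤ 1) :
    Tendsto (fun δ : ℝ => errorQuotient f x δ (x + (δ * ‖x‖) • u)) (𝓝[>] 0)
      (𝓝 (‖x‖ / ‖f x‖ * ‖A u‖)) := by
  rw [Metric.tendsto_nhds]
  intro ε hε
  filter_upwards [eventually_abs_errorQuotient_sub_le hf hx hfx (half_pos hε)] with δ h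
  rw [Real.dist_eq]
  linarith [h u hu]

theorem eventually_continuousOn_comp_add_smul (hdiff : ∀ᶠ y in 𝓝 x, DifferentiableAt ℝ f y) :
    ∀ᶠ δ in 𝓝[>] (0 : ℝ), ContinuousOn (fun u => f (x + (δ * ‖x‖) • u)) (Metric.closedBall 0 1) := by
  filter_upwards [eventually_forall_add_smul x hdiff] with δ h u hu
  have h1 := (h u (by simpa using hu)).continuousAt
  exact (ContinuousAt.comp (f := fun u => x + (δ * ‖x‖) • u) h1 (by fun_prop)).continuousWithinAt

theorem eventually_continuousOn_errorQuotient (hdiff : ∀ᶠ y in 𝓝 x, DifferentiableAt ℝ f y) :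
    ∀ᶠ δ in 𝓝[>] (0 : ℝ), ContinuousOn (fun u => errorQuotient f x δ (x + (δ * ‖x‖) • u))
      (Metric.closedBall 0 1) := by
  filter_upwards [eventually_continuousOn_comp_add_smul hdiff] with δ h
  exact ((h.sub continuousOn_const).norm).div_const _

theorem errorQuotient_nonneg {δ : ℝ} (hδ : 0 < δ) (y : EuclideanSpace ℝ (Fin m)) :
    0 ≤ errorQuotient f x δ y := by
  unfold errorQuotient
  positivity

/-- Uniform convergence bounds the suprema from above; the top singular vector `v`, where `‖A v‖ =
‖A‖`, bounds them from below. -/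
theorem isWNC_of_hasFDerivAt {A : EuclideanSpace ℝ (Fin m) →L[ℝ] EuclideanSpace ℝ (Fin n)}
    (hf : HasFDerivAt f A x) (hx : x ≠ 0) (hfx : f x ≠ 0) (hA : A ≠ 0) :
    IsWNC f x (‖x‖ / ‖f x‖ * ‖A‖) := by
  obtain ⟨v, w, hv, hw, hvw⟩ := exists_top_singular_pair A hA
  have hAv : ‖A‖ ≤ ‖A v‖ := by
    have h1 := hvw v
    rw [real_inner_self_eq_norm_sq, hv, one_pow, mul_one] at h1
    have h2 := real_inner_le_norm w (A v)
    rw [hw, one_mul] at h2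
    linarith
  have hle : ∀ u : EuclideanSpace ℝ (Fin m), ‖u‖ ≤ 1 →
      ‖x‖ / ‖f x‖ * ‖A u‖ ≤ ‖x‖ / ‖f x‖ * ‖A‖ := by
    intro u hu
    gcongr
    exact A.unit_le_opNorm u hu
  have hub : ∀ ε > 0, ∀ᶠ δ in 𝓝[>] (0 : ℝ), ∀ q ∈ errorQuotient f x δ '' perturbationSet x δ,
      q ≤ ‖x‖ / ‖f x‖ * ‖A‖ + ε := by
    intro ε hε
    filter_upwards [eventually_abs_errorQuotient_sub_le hf hx hfx hε, self_mem_nhdsWithin]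
      with δ h hδ
    rw [perturbationSet_eq_image hx hδ, Set.image_image]
    rintro _ ⟨u, hu, rfl⟩
    have hu' : ‖u‖ ≤ 1 := by simpa using hu
    linarith [(abs_le.1 (h u hu')).2, hle u hu']
  refine ⟨(hub 1 one_pos).mono fun δ h => ⟨_, h⟩, ?_⟩
  rw [Metric.tendsto_nhds]
  intro ε hε
  filter_upwards [hub (ε / 2) (by linarith), self_mem_nhdsWithin,
    eventually_abs_errorQuotient_sub_le hf hx hfx (half_pos hε)] with δ h1 hδ h2
  have hmem : errorQuotient f x δ (x + (δ * ‖x‖) • v) ∈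
      errorQuotient f x δ '' perturbationSet x δ := by
    refine Set.mem_image_of_mem _ ?_
    rw [perturbationSet_eq_image hx hδ]
    exact Set.mem_image_of_mem _ (by simp [hv])
  have h3 := csSup_le ⟨_, hmem⟩ h1
  have h4 := le_csSup ⟨_, h1⟩ hmem
  have h5 := (abs_le.1 (h2 v hv.le)).1
  have h6 : ‖x‖ / ‖f x‖ * ‖A‖ ≤ ‖x‖ / ‖f x‖ * ‖A v‖ := by gcongr
  rw [Real.dist_eq, abs_lt]
  constructor <;> linarith

theorem isSNC_of_hasFDerivAt {A : EuclideanSpace ℝ (Fin m) →L[ℝ] EuclideanSpace ℝ (Fin n)}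
    (hdiff : ∀ᶠ y in 𝓝 x, DifferentiableAt ℝ f y)
    (hf : HasFDerivAt f A x) (hx : x ≠ 0) (hfx : f x ≠ 0) :
    IsSNC f x (∫ u, ‖x‖ / ‖f x‖ * ‖A u‖
      ∂volume[|Metric.closedBall (0 : EuclideanSpace ℝ (Fin m)) 1]) := by
  constructor
  · filter_upwards [eventually_continuousOn_errorQuotient hdiff, self_mem_nhdsWithin] with δ h hδ
    rw [integrableOn_perturbationSet_iff hx hδ]
    exact h.integrable_cond_closedBall
  · have hlim : Tendsto (fun δ : ℝ => ∫ u, errorQuotient f x δ (x + (δ * ‖x‖) • u)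
        ∂volume[|Metric.closedBall (0 : EuclideanSpace ℝ (Fin m)) 1]) (𝓝[>] 0)
        (𝓝 (∫ u, ‖x‖ / ‖f x‖ * ‖A u‖
          ∂volume[|Metric.closedBall (0 : EuclideanSpace ℝ (Fin m)) 1])) := by
      refine tendsto_integral_filter_of_dominated_convergence
        (fun _ => ‖x‖ / ‖f x‖ * ‖A‖ + 1) ?_ ?_ (integrable_const _) ?_
      · filter_upwards [eventually_continuousOn_errorQuotient hdiff] with δ h
        exact h.aestronglyMeasurable_cond_closedBall
      · filter_upwards [eventually_abs_errorQuotient_sub_le hf hx hfx one_pos,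
          self_mem_nhdsWithin] with δ h hδ
        filter_upwards [ae_cond_closedBall_norm_le] with u hu
        rw [Real.norm_of_nonneg (errorQuotient_nonneg hδ _)]
        have : ‖x‖ / ‖f x‖ * ‖A u‖ ≤ ‖x‖ / ‖f x‖ * ‖A‖ := by
          gcongr
          exact A.unit_le_opNorm u hu
        linarith [(abs_le.1 (h u hu)).2]
      · filter_upwards [ae_cond_closedBall_norm_le] with u hu
        exact tendsto_errorQuotient hf hx hfx hu
    refine hlim.congr' ?_
    filter_upwards [self_mem_nhdsWithin] with δ hδ
    rw [setAverage_perturbationSet hx hδ]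

end ErrorQuotient

/-! ### Logarithmic means and the loss of precision. -/

section LossOfPrecision

open ProbabilityTheory

/-- Jensen's inequality for the logarithm in tangent-line form. -/
theorem integral_log_le {Ω : Type*} [MeasurableSpace Ω] {μ : Measure Ω} [IsProbabilityMeasure μ]
    {q : Ω → ℝ} (hq : Integrable q μ) (hlog : Integrable (fun ω => Real.log (q ω)) μ)
    (hpos : ∀ᵐ ω ∂μ, 0 < q ω) {a : ℝ} (ha : 0 < a) :
    ∫ ω, Real.log (q ω) ∂μ ≤ Real.log a + (∫ ω, q ω ∂μ) / a - 1 := by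
  have h1 : ∫ ω, Real.log (q ω) ∂μ ≤ ∫ ω, (q ω / a + (Real.log a - 1)) ∂μ := by
    refine integral_mono_ae hlog ((hq.div_const a).add (integrable_const _)) ?_
    filter_upwards [hpos] with ω hω
    have := Real.log_le_sub_one_of_pos (div_pos hω ha)
    rw [Real.log_div hω.ne' ha.ne'] at this
    change Real.log (q ω) ≤ q ω / a + (Real.log a - 1)
    linarith
  rw [integral_add (hq.div_const a) (integrable_const _), integral_div] at h1
  simp only [integral_const, probReal_univ, one_smul] at h1
  linarith

variable {m n : ℕ}

/-- Lower tail of `log q` on the unit ball when `q` dominates a function that grows at rate `κ`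
in some direction. -/
theorem cond_closedBall_log_le {v : EuclideanSpace ℝ (Fin m)} (hv : ‖v‖ = 1)
    {h q : EuclideanSpace ℝ (Fin m) → ℝ} (hc : ContinuousOn h (Metric.closedBall 0 1)) {κ : ℝ}
    (hκ : 0 < κ)
    (hgrow : ∀ u ∈ Metric.closedBall (0 : EuclideanSpace ℝ (Fin m)) 1, ∀ a : ℝ, 0 ≤ a →
      u + a • v ∈ Metric.closedBall (0 : EuclideanSpace ℝ (Fin m)) 1 →
        κ * a ≤ h (u + a • v) - h u)
    (hq : ∀ u ∈ Metric.closedBall (0 : EuclideanSpace ℝ (Fin m)) 1, |h u| ≤ q u) (s : ℝ) :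
    volume[|Metric.closedBall (0 : EuclideanSpace ℝ (Fin m)) 1] {u | Real.log (q u) ≤ -s} ≤
      ENNReal.ofReal (√m / κ * Real.exp (-s)) := by
  refine (measure_mono_ae ?_).trans
    (cond_closedBall_abs_le hv hc hκ hgrow (Real.exp_pos (-s)).le)
  filter_upwards [ae_cond_closedBall_norm_le] with u hu hus
  have hle := hq u (by simpa using hu)
  change |h u| ≤ Real.exp (-s)
  -- Where `q u = 0`, the convention `Real.log 0 = 0` carries no information, but there `h u = 0` as
  -- well.
  rcases (((abs_nonneg _).trans hle).eq_or_lt) with h0 | h0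
  · rw [← h0] at hle
    exact hle.trans (Real.exp_pos _).le
  · exact hle.trans ((Real.log_le_iff_le_exp h0).1 hus)

/-- The slab estimate at `t = 0`: the zero set of `h` is null. -/
theorem ae_cond_closedBall_pos {v : EuclideanSpace ℝ (Fin m)} (hv : ‖v‖ = 1)
    {h q : EuclideanSpace ℝ (Fin m) → ℝ} (hc : ContinuousOn h (Metric.closedBall 0 1)) {κ : ℝ}
    (hκ : 0 < κ)
    (hgrow : ∀ u ∈ Metric.closedBall (0 : EuclideanSpace ℝ (Fin m)) 1, ∀ a : ℝ, 0 ≤ a →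
      u + a • v ∈ Metric.closedBall (0 : EuclideanSpace ℝ (Fin m)) 1 →
        κ * a ≤ h (u + a • v) - h u)
    (hq : ∀ u ∈ Metric.closedBall (0 : EuclideanSpace ℝ (Fin m)) 1, |h u| ≤ q u) :
    ∀ᵐ u ∂volume[|Metric.closedBall (0 : EuclideanSpace ℝ (Fin m)) 1], 0 < q u := by
  have h0 := cond_closedBall_abs_le hv hc hκ hgrow le_rfl
  rw [mul_zero, ENNReal.ofReal_zero, nonpos_iff_eq_zero, measure_eq_zero_iff_ae_notMem] at h0
  filter_upwards [h0, ae_cond_closedBall_norm_le] with u h1 hu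
  have h2 : ¬ |h u| ≤ 0 := h1
  exact (not_le.1 h2).trans_le (hq u (by simpa using hu))

/-! ### The linear model `c * ‖A u‖`. -/

section LinearMap

variable {A : EuclideanSpace ℝ (Fin m) →L[ℝ] EuclideanSpace ℝ (Fin n)} {c : ℝ}
  {v : EuclideanSpace ℝ (Fin m)} {w : EuclideanSpace ℝ (Fin n)}

theorem abs_mul_inner_le (hw : ‖w‖ = 1) (hc : 0 < c)
    (hvw : ∀ u, inner ℝ w (A u) = ‖A‖ * inner ℝ v u) (u : EuclideanSpace ℝ (Fin m)) :
    |c * ‖A‖ * inner ℝ v u| ≤ c * ‖A u‖ := by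
  rw [mul_assoc, ← hvw, abs_mul, abs_of_pos hc]
  gcongr
  simpa [hw] using abs_real_inner_le_norm w (A u)

theorem mul_inner_add_smul_sub (hv : ‖v‖ = 1) (κ a : ℝ) (u : EuclideanSpace ℝ (Fin m)) :
    κ * inner ℝ v (u + a • v) - κ * inner ℝ v u = κ * a := by
  rw [inner_add_right, inner_smul_right, real_inner_self_eq_norm_sq, hv]
  ring

theorem ae_cond_closedBall_norm_map_pos (hA : A ≠ 0) (hc : 0 < c) :
    ∀ᵐ u ∂volume[|Metric.closedBall (0 : EuclideanSpace ℝ (Fin m)) 1], 0 < c * ‖A u‖ := by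
  obtain ⟨v, w, hv, hw, hvw⟩ := exists_top_singular_pair A hA
  have hA' : 0 < ‖A‖ := norm_pos_iff.2 hA
  exact ae_cond_closedBall_pos (h := fun u => c * ‖A‖ * inner ℝ v u) hv (by fun_prop)
    (mul_pos hc hA') (fun u _ a _ _ => (mul_inner_add_smul_sub hv _ a u).ge)
    fun u _ => abs_mul_inner_le hw hc hvw u

theorem cond_closedBall_log_norm_map_le (hA : A ≠ 0) (hc : 0 < c) (s : ℝ) :
    volume[|Metric.closedBall (0 : EuclideanSpace ℝ (Fin m)) 1]
        {u | Real.log (c * ‖A u‖) ≤ -s} ≤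
      ENNReal.ofReal (√m / (c * ‖A‖) * Real.exp (-s)) := by
  obtain ⟨v, w, hv, hw, hvw⟩ := exists_top_singular_pair A hA
  have hA' : 0 < ‖A‖ := norm_pos_iff.2 hA
  exact cond_closedBall_log_le (h := fun u => c * ‖A‖ * inner ℝ v u)
    (q := fun u => c * ‖A u‖) hv (by fun_prop)
    (mul_pos hc hA') (fun u _ a _ _ => (mul_inner_add_smul_sub hv _ a u).ge)
    (fun u _ => abs_mul_inner_le hw hc hvw u) s

theorem log_norm_map_le (hc : 0 < c) {u : EuclideanSpace ℝ (Fin m)} (hu : ‖u‖ ≤ 1) :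
    Real.log (c * ‖A u‖) ≤ c * ‖A‖ := by
  refine (Real.log_le_self (by positivity)).trans ?_
  gcongr
  exact A.unit_le_opNorm u hu

theorem aestronglyMeasurable_log_norm_map (A : EuclideanSpace ℝ (Fin m) →L[ℝ]
      EuclideanSpace ℝ (Fin n)) (c : ℝ) {μ : Measure (EuclideanSpace ℝ (Fin m))} :
    AEStronglyMeasurable (fun u => Real.log (c * ‖A u‖)) μ := by
  have : Measurable fun u => Real.log (c * ‖A u‖) := by fun_prop
  exact this.aestronglyMeasurable

theorem integrable_log_norm_map (hA : A ≠ 0) (hc : 0 < c) :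
    Integrable (fun u => Real.log (c * ‖A u‖))
      (volume[|Metric.closedBall (0 : EuclideanSpace ℝ (Fin m)) 1]) := by
  refine integrable_of_tail (K := c * ‖A‖) (aestronglyMeasurable_log_norm_map A c) (by positivity)
    ?_ (cond_closedBall_log_norm_map_le hA hc)
  filter_upwards [ae_cond_closedBall_norm_le] with u hu using log_norm_map_le hc hu

/-- Lower bound for the mean logarithm of `‖A u‖` with `u` uniform in the unit ball. -/
theorem log_sub_le_integral_log_norm_map (hm : 0 < m) (hA : A ≠ 0) (hc : 0 < c) :
    Real.log (c * ‖A‖) - Real.log m / 2 - 1 ≤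
      ∫ u, Real.log (c * ‖A u‖) ∂volume[|Metric.closedBall (0 : EuclideanSpace ℝ (Fin m)) 1] := by
  have hA' : 0 < ‖A‖ := norm_pos_iff.2 hA
  have hm' : (0 : ℝ) < m := by exact_mod_cast hm
  have hmr : 0 < √(m : ℝ) := Real.sqrt_pos.2 hm'
  have h := neg_log_sub_one_le_integral (K := c * ‖A‖) (aestronglyMeasurable_log_norm_map A c)
    (show 0 < √m / (c * ‖A‖) by positivity)
    (ae_cond_closedBall_norm_le.mono fun u hu => log_norm_map_le hc hu)
    (cond_closedBall_log_norm_map_le hA hc)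
  rw [Real.log_div hmr.ne' (by positivity), Real.log_sqrt hm'.le] at h
  linarith

theorem integral_norm_map_pos (hA : A ≠ 0) (hc : 0 < c) :
    0 < ∫ u, c * ‖A u‖ ∂volume[|Metric.closedBall (0 : EuclideanSpace ℝ (Fin m)) 1] := by
  have hnn : 0 ≤ fun u => c * ‖A u‖ := fun u => by positivity
  refine (integral_nonneg hnn).lt_of_ne' fun h0 => ?_
  rw [integral_eq_zero_iff_of_nonneg hnn
    (ContinuousOn.integrable_cond_closedBall (by fun_prop))] at h0
  obtain ⟨u, h1, h2⟩ := (h0.and (ae_cond_closedBall_norm_map_pos hA hc)).exists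
  exact h2.ne' h1

theorem integral_log_norm_map_le_log_integral (hA : A ≠ 0) (hc : 0 < c) :
    ∫ u, Real.log (c * ‖A u‖) ∂volume[|Metric.closedBall (0 : EuclideanSpace ℝ (Fin m)) 1] ≤
      Real.log (∫ u, c * ‖A u‖
        ∂volume[|Metric.closedBall (0 : EuclideanSpace ℝ (Fin m)) 1]) := by
  have hS := integral_norm_map_pos (m := m) hA hc
  have h := integral_log_le (ContinuousOn.integrable_cond_closedBall (by fun_prop))
    (integrable_log_norm_map hA hc) (ae_cond_closedBall_norm_map_pos hA hc) hS
  rwa [div_self hS.ne', add_sub_cancel_right] at h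

end LinearMap

variable {f : EuclideanSpace ℝ (Fin m) → EuclideanSpace ℝ (Fin n)}
  {x : EuclideanSpace ℝ (Fin m)}

/-- The loss of precision is at most the logarithm of the stochastic condition number. -/
theorem IsSNLP.le_logb {L S : ℝ} (hL : IsSNLP f x L) (hS : IsSNC f x S) (hS0 : 0 < S)
    (hx : x ≠ 0) : L ≤ Real.logb 2 S := by
  have hlog2 : 0 < Real.log 2 := Real.log_pos one_lt_two
  -- The tangent to `log` is taken at the limit `S`, not at the mean for the given `δ`; its error
  -- terms cancel as `δ → 0`.
  have hlim : Tendsto (fun δ : ℝ => (Real.log S +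
      (⨍ x' in perturbationSet x δ, errorQuotient f x δ x' ∂volume) / S - 1) / Real.log 2)
      (𝓝[>] 0) (𝓝 ((Real.log S + S / S - 1) / Real.log 2)) :=
    (((hS.2.div_const S).const_add _).sub_const 1).div_const _
  rw [div_self hS0.ne', add_sub_cancel_right] at hlim
  refine le_of_tendsto_of_tendsto hL.2 hlim ?_
  filter_upwards [hL.1, hS.1, self_mem_nhdsWithin] with δ h1 h2 hδ
  have hδ' : 0 < δ := hδ
  rw [setAverage_perturbationSet hx hδ, setAverage_perturbationSet hx hδ]
  have h3 := (integrableOn_perturbationSet_iff hx hδ _).1 h1.2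
  have h4 := (integrableOn_perturbationSet_iff hx hδ _).1 h2
  have h5 := (ae_restrict_perturbationSet_iff hx hδ _).1 h1.1
  simp only [Real.logb] at h3 ⊢
  rw [integral_div]
  gcongr
  refine integral_log_le h4 ?_ ?_ hS0
  · refine (h3.mul_const (Real.log 2)).congr (ae_of_all _ fun u => ?_)
    exact div_mul_cancel₀ _ hlog2.ne'
  · filter_upwards [h5] with u hu
    exact (errorQuotient_nonneg hδ' _).lt_of_ne' hu

/-- For a strictly differentiable map the rescaled error quotients dominate functions that grow
at a uniform rate in a fixed direction. -/
theorem eventually_errorQuotient_growth {A : EuclideanSpace ℝ (Fin m) →L[ℝ] EuclideanSpace ℝ (Fin n)}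
    (hdiff : ∀ᶠ y in 𝓝 x, DifferentiableAt ℝ f y) (hf : HasStrictFDerivAt f A x)
    (hx : x ≠ 0) (hfx : f x ≠ 0) {v : EuclideanSpace ℝ (Fin m)} {w : EuclideanSpace ℝ (Fin n)}
    (hA : A ≠ 0) (hv : ‖v‖ = 1) (hw : ‖w‖ = 1)
    (hvw : ∀ u, inner ℝ w (A u) = ‖A‖ * inner ℝ v u) :
    ∀ᶠ δ in 𝓝[>] (0 : ℝ), ∃ h : EuclideanSpace ℝ (Fin m) → ℝ,
      ContinuousOn h (Metric.closedBall 0 1) ∧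
      (∀ u ∈ Metric.closedBall (0 : EuclideanSpace ℝ (Fin m)) 1, ∀ a : ℝ, 0 ≤ a →
        u + a • v ∈ Metric.closedBall (0 : EuclideanSpace ℝ (Fin m)) 1 →
          ‖x‖ / ‖f x‖ * ‖A‖ / 2 * a ≤ h (u + a • v) - h u) ∧
      ∀ u ∈ Metric.closedBall (0 : EuclideanSpace ℝ (Fin m)) 1,
        |h u| ≤ errorQuotient f x δ (x + (δ * ‖x‖) • u) := by
  have hA' : 0 < ‖A‖ := norm_pos_iff.2 hA
  have hx' : 0 < ‖x‖ := norm_pos_iff.2 hx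
  have hfx' : 0 < ‖f x‖ := norm_pos_iff.2 hfx
  -- Allowing an error of `‖A‖ / 2` leaves half of the linear growth rate. The loss is harmless:
  -- this rate serves only for uniform integrability, not for the final constants.
  have hs := (hf.isLittleO.def (half_pos hA'))
  rw [nhds_prod_eq] at hs
  obtain ⟨p, hp, hps⟩ := (eventually_prod_self_iff
    (r := fun y z => ‖f y - f z - A (y - z)‖ ≤ ‖A‖ / 2 * ‖y - z‖)).1 hs
  filter_upwards [eventually_continuousOn_comp_add_smul hdiff, eventually_forall_add_smul x hp,
    self_mem_nhdsWithin] with δ hcont hδp hδ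
  have hδ' : 0 < δ := hδ
  have hρ : 0 < δ * ‖x‖ := by positivity
  -- The component along `w` of the scaled increment; since `‖w‖ = 1`, Cauchy–Schwarz bounds it by
  -- the error quotient.
  refine ⟨fun u => inner ℝ w (f (x + (δ * ‖x‖) • u) - f x) / (δ * ‖f x‖), ?_, ?_, ?_⟩
  · exact (continuousOn_const.inner (hcont.sub continuousOn_const)).div_const _
  · intro u hu a ha hua
    -- Strict differentiability enters here: both points vary near `x`, and the error is measured
    -- against their mutual distance.
    have h1 := hps _ (hδp _ (by simpa using hua)) _ (hδp u (by simpa using hu))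
    set y := x + (δ * ‖x‖) • (u + a • v) with hy
    set z := x + (δ * ‖x‖) • u with hz
    have hyz : y - z = (δ * ‖x‖ * a) • v := by
      rw [hy, hz, smul_add, smul_smul]
      abel
    have hnorm : ‖y - z‖ = δ * ‖x‖ * a := by
      rw [hyz, norm_smul, hv, mul_one, Real.norm_of_nonneg (by positivity)]
    have h2 : ‖f y - f z - A (y - z)‖ ≤ ‖A‖ / 2 * (δ * ‖x‖ * a) := by
      rw [← hnorm]
      exact h1
    have h3 : -(‖A‖ / 2 * (δ * ‖x‖ * a)) ≤ inner ℝ w (f y - f z - A (y - z)) := by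
      have := abs_real_inner_le_norm w (f y - f z - A (y - z))
      rw [hw, one_mul] at this
      linarith [(abs_le.1 (this.trans h2)).1]
    have h4 : (inner ℝ w (A (y - z)) : ℝ) = ‖A‖ * (δ * ‖x‖ * a) := by
      rw [hvw, hyz, inner_smul_right, real_inner_self_eq_norm_sq, hv]
      ring
    rw [inner_sub_right, h4] at h3
    rw [← sub_div, ← inner_sub_right, sub_sub_sub_cancel_right, le_div_iff₀ (by positivity)]
    calc ‖x‖ / ‖f x‖ * ‖A‖ / 2 * a * (δ * ‖f x‖) = ‖A‖ / 2 * (δ * ‖x‖ * a) := by field_simp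
      _ ≤ _ := by linarith
  · intro u hu
    rw [abs_div, abs_of_pos (show 0 < δ * ‖f x‖ by positivity)]
    unfold errorQuotient
    gcongr
    simpa [hw] using abs_real_inner_le_norm w (f (x + (δ * ‖x‖) • u) - f x)

theorem isSNLP_of_hasStrictFDerivAt
    {A : EuclideanSpace ℝ (Fin m) →L[ℝ] EuclideanSpace ℝ (Fin n)}
    (hdiff : ∀ᶠ y in 𝓝 x, DifferentiableAt ℝ f y) (hf : HasStrictFDerivAt f A x)
    (hx : x ≠ 0) (hfx : f x ≠ 0) (hA : A ≠ 0) :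
    IsSNLP f x ((∫ u, Real.log (‖x‖ / ‖f x‖ * ‖A u‖)
      ∂volume[|Metric.closedBall (0 : EuclideanSpace ℝ (Fin m)) 1]) / Real.log 2) := by
  obtain ⟨v, w, hv, hw, hvw⟩ := exists_top_singular_pair A hA
  have hA' : 0 < ‖A‖ := norm_pos_iff.2 hA
  have hc : 0 < ‖x‖ / ‖f x‖ := div_pos (norm_pos_iff.2 hx) (norm_pos_iff.2 hfx)
  have hκ : 0 < ‖x‖ / ‖f x‖ * ‖A‖ / 2 := by positivity
  set W := ‖x‖ / ‖f x‖ * ‖A‖ with hW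
  set μ := volume[|Metric.closedBall (0 : EuclideanSpace ℝ (Fin m)) 1] with hμ
  have hgrow := eventually_errorQuotient_growth hdiff hf hx hfx hA hv hw hvw
  have hmeas : ∀ᶠ δ in 𝓝[>] (0 : ℝ), AEStronglyMeasurable
      (fun u => Real.log (errorQuotient f x δ (x + (δ * ‖x‖) • u))) μ := by
    filter_upwards [eventually_continuousOn_errorQuotient hdiff] with δ h
    exact (Real.measurable_log.comp_aemeasurable
      h.aestronglyMeasurable_cond_closedBall.aemeasurable).aestronglyMeasurable
  have hbound : ∀ᶠ δ in 𝓝[>] (0 : ℝ), ∀ᵐ u ∂μ,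
      Real.log (errorQuotient f x δ (x + (δ * ‖x‖) • u)) ≤ W + 1 := by
    filter_upwards [eventually_abs_errorQuotient_sub_le hf.hasFDerivAt hx hfx one_pos,
      self_mem_nhdsWithin] with δ h hδ
    filter_upwards [ae_cond_closedBall_norm_le] with u hu
    refine (Real.log_le_self (errorQuotient_nonneg hδ _)).trans ?_
    have : ‖x‖ / ‖f x‖ * ‖A u‖ ≤ W := by
      rw [hW]
      gcongr
      exact A.unit_le_opNorm u hu
    linarith [(abs_le.1 (h u hu)).2]
  have htail : ∀ᶠ δ in 𝓝[>] (0 : ℝ), ∀ s : ℝ,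
      μ {u | Real.log (errorQuotient f x δ (x + (δ * ‖x‖) • u)) ≤ -s} ≤
        ENNReal.ofReal (√m / (W / 2) * Real.exp (-s)) := by
    filter_upwards [hgrow] with δ ⟨h, h1, h2, h3⟩ s
    exact cond_closedBall_log_le hv h1 hκ h2 h3 s
  have hlim : Tendsto (fun δ : ℝ => ∫ u, Real.log (errorQuotient f x δ (x + (δ * ‖x‖) • u)) ∂μ)
      (𝓝[>] 0) (𝓝 (∫ u, Real.log (‖x‖ / ‖f x‖ * ‖A u‖) ∂μ)) := by
    refine tendsto_integral_of_tail (K := W + 1) (by positivity) hmeas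
      (aestronglyMeasurable_log_norm_map A _) hbound ?_ htail (fun s => ?_) ?_
    · filter_upwards [ae_cond_closedBall_norm_le] with u hu
      linarith [log_norm_map_le (A := A) hc hu]
    -- The limit satisfies the tail bound with `√m / W`, weakened to the constant `√m / (W / 2)`
    -- shared with the quotients.
    · refine (cond_closedBall_log_norm_map_le hA hc s).trans (ENNReal.ofReal_le_ofReal ?_)
      gcongr
      linarith
    · filter_upwards [ae_cond_closedBall_norm_le, ae_cond_closedBall_norm_map_pos hA hc]
        with u hu hpos
      exact (tendsto_errorQuotient hf.hasFDerivAt hx hfx hu).log hpos.ne'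
  constructor
  · filter_upwards [hmeas, hbound, htail, hgrow, self_mem_nhdsWithin]
      with δ h1 h2 h3 ⟨h, g1, g2, g3⟩ hδ
    constructor
    · rw [ae_restrict_perturbationSet_iff hx hδ]
      filter_upwards [ae_cond_closedBall_pos hv g1 hκ g2 g3] with u hu using hu.ne'
    · rw [integrableOn_perturbationSet_iff hx hδ]
      exact (integrable_of_tail h1 (by positivity) h2 h3).div_const _
  · refine (hlim.div_const (Real.log 2)).congr' ?_
    filter_upwards [self_mem_nhdsWithin] with δ hδ
    rw [setAverage_perturbationSet hx hδ]
    simp only [Real.logb]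
    rw [integral_div]

end LossOfPrecision

/-! ### Assembly of the bounds. -/

theorem theorem1 {m n : ℕ}
    (f : EuclideanSpace ℝ (Fin m) → EuclideanSpace ℝ (Fin n))
    (x : EuclideanSpace ℝ (Fin m))
    (hdiff : ∀ᶠ y in 𝓝 x, DifferentiableAt ℝ f y)
    (hx : x ≠ 0) (hfx : f x ≠ 0) (hderiv : fderiv ℝ f x ≠ 0) :
    ∃ W S : ℝ, IsWNC f x W ∧ IsSNC f x S ∧ 0 < W ∧
      1 / (Real.exp 1 * √(m : ℝ)) ≤ S / W ∧
      S / W ≤ √(((min m n : ℕ) : ℝ) / ((m : ℝ) + 2)) ∧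
      -- the upper bound for the loss of precision, whenever the latter exists
      (∀ L : ℝ, IsSNLP f x L →
        L - Real.logb 2 W ≤
          (Real.logb 2 ((min m n : ℕ) : ℝ) - Real.logb 2 ((m : ℝ) + 2)) / 2) ∧
      -- existence of the loss of precision, and both bounds, for example for `C¹` problems
      (HasStrictFDerivAt f (fderiv ℝ f x) x →
        ∃ L : ℝ, IsSNLP f x L ∧
          -(Real.logb 2 (m : ℝ)) / 2 - Real.logb 2 (Real.exp 1) ≤ L - Real.logb 2 W ∧
          L - Real.logb 2 W ≤
            (Real.logb 2 ((min m n : ℕ) : ℝ) - Real.logb 2 ((m : ℝ) + 2)) / 2) := by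
  have hA := hderiv
  set A := fderiv ℝ f x with hAdef
  have hf : HasFDerivAt f A x := hdiff.self_of_nhds.hasFDerivAt
  have hm : 0 < m := by
    rcases Nat.eq_zero_or_pos m with rfl | h
    · exact absurd (Subsingleton.elim x 0) hx
    · exact h
  have hn : 0 < n := by
    rcases Nat.eq_zero_or_pos n with rfl | h
    · exact absurd (Subsingleton.elim (f x) 0) hfx
    · exact h
  have hm' : (0 : ℝ) < m := by exact_mod_cast hm
  have hk : (0 : ℝ) < ((min m n : ℕ) : ℝ) := by exact_mod_cast lt_min hm hn
  have hA' : 0 < ‖A‖ := norm_pos_iff.2 hA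
  have hc : 0 < ‖x‖ / ‖f x‖ := div_pos (norm_pos_iff.2 hx) (norm_pos_iff.2 hfx)
  have hW : 0 < ‖x‖ / ‖f x‖ * ‖A‖ := mul_pos hc hA'
  have hlog2 : 0 < Real.log 2 := Real.log_pos one_lt_two
  have hSNC := isSNC_of_hasFDerivAt hdiff hf hx hfx
  have hS := integral_norm_map_pos (m := m) hA hc
  have hlower := log_sub_le_integral_log_norm_map hm hA hc
  have hjensen := integral_log_norm_map_le_log_integral (m := m) hA hc
  have hSle : ∫ u, ‖x‖ / ‖f x‖ * ‖A u‖
      ∂ProbabilityTheory.cond volume (Metric.closedBall (0 : EuclideanSpace ℝ (Fin m)) 1) ≤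
        ‖x‖ / ‖f x‖ * ‖A‖ * √(((min m n : ℕ) : ℝ) / ((m : ℝ) + 2)) := by
    rw [integral_const_mul, mul_assoc]
    exact mul_le_mul_of_nonneg_left (integral_norm_map_le hm A) hc.le
  set S := ∫ u, ‖x‖ / ‖f x‖ * ‖A u‖
    ∂ProbabilityTheory.cond volume (Metric.closedBall (0 : EuclideanSpace ℝ (Fin m)) 1) with hSdef
  set W := ‖x‖ / ‖f x‖ * ‖A‖ with hWdef
  have hupper : ∀ L : ℝ, IsSNLP f x L → L - Real.logb 2 W ≤
      (Real.logb 2 ((min m n : ℕ) : ℝ) - Real.logb 2 ((m : ℝ) + 2)) / 2 := by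
    intro L hL
    have h1 := hL.le_logb hSNC hS hx
    have h2 : Real.logb 2 S ≤ Real.logb 2 (W * √(((min m n : ℕ) : ℝ) / ((m : ℝ) + 2))) :=
      Real.logb_le_logb_of_le one_lt_two hS hSle
    rw [Real.logb_mul hW.ne' (by positivity), Real.sqrt_eq_rpow,
      Real.logb_rpow_eq_mul_logb_of_pos (by positivity),
      Real.logb_div hk.ne' (by positivity)] at h2
    linarith
  refine ⟨W, S, isWNC_of_hasFDerivAt hf hx hfx hA, hSNC, hW, ?_, ?_, hupper, fun hstrict => ?_⟩
  -- After taking logarithms, this is the lower bound for `E log(c‖A u‖)` followed by Jensen's `E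
  -- log ≤ log E`.
  · rw [le_div_iff₀ hW, ← Real.log_le_log_iff (by positivity) hS,
      Real.log_mul (by positivity) hW.ne', one_div, Real.log_inv,
      Real.log_mul (Real.exp_pos 1).ne' (by positivity), Real.log_exp, Real.log_sqrt hm'.le]
    linarith
  · rw [div_le_iff₀ hW, mul_comm]
    exact hSle
  · have hL := isSNLP_of_hasStrictFDerivAt hdiff hstrict hx hfx hA
    refine ⟨_, hL, ?_, hupper _ hL⟩
    simp only [Real.logb, Real.log_exp]
    rw [← sub_div, neg_div, div_right_comm, ← neg_div, ← sub_div]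
    exact div_le_div_of_nonneg_right (by linarith) hlog2.le
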